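/- Let $\mathfrak W$ be an abelian semigroup (written additively, not necessarily with a neutral element). A $\mathfrak W$-weighted graph $(\Gamma,h)$ is a finite graph $\Gamma=(V,E)$, with loops and multiple edges allowed, together with a function $h:V\to\mathfrak W$. For $S\subseteq E$ let $\pi(S)$ be the set of vertex sets of the connected components of $(V,S)$, let $c(S)=|\pi(S)|$, and put $h(B)=\sum_{w\in B}h(w)$ for $B\in\pi(S)$. The contraction $(\Gamma/e,h/e)$ of a link (non-loop edge) $e$ is the usual contraction, the vertex obtained by identifying the endpoints of $e$ receiving the sum of their weights. With independent variables $v$ and $u_k$ ($k\in\mathfrak W$), define $$Q_{(\Gamma,h)}(\mathbf u,v)=\sum_{S\subseteq E}v^{|S|-|V|+c(S)}\prod_{B\in\pi(S)}u_{h(B)}\in\mathbb Z[\mathbf u,v].$$ For a commutative ring $R$, a family $x=(x_k)_{k\in\mathfrak W}$ in $R$ and $y\in R$, consider the following properties of an $R$-valued function $f$ of $\mathfrak W$-weighted graphs: (a) $f(\Gamma,h)=f(\Gamma\setminus e,h)+f(\Gamma/e,h/e)$ for every link $e$; (b) $f(\Gamma,h)=f(\Gamma',h')$ if $(\Gamma,h)$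 and $(\Gamma',h')$ are isomorphic (as weighted graphs); (c) $f(\emptyset)=1$; (d) $f((V,\emptyset),h)=\prod_{w\in V}x_{h(w)}$; (e) $f(\Gamma,h)=(y+1)\,f(\Gamma\setminus e,h)$ for every loop $e$. Then: (1) $(\Gamma,h)\mapsto Q_{(\Gamma,h)}(\mathbf u,v)$ has the properties (a)–(e), with $R=\mathbb Z[\mathbf u,v]$, $x_k=u_k$, $y=v$. (2) It is universal with these properties: for every commutative ring $R$, all $x$ and $y$ as above, and every $R$-valued function $f$ of $\mathfrak W$-weighted graphs, $f$ has the properties (a)–(e) if and only if $f(\Gamma,h)=Q_{(\Gamma,h)}(\mathbf u,v)\big|_{u_k=x_k,\,v=y}$ for all $(\Gamma,h)$. (3) $Q$ is multiplicative: $Q_{(\Gamma,h)}$ is the product of the polynomials $Q$ of the connected components of $(\Gamma,h)$ (with the restricted weights). (4) $Q$ has a spanning-tree expansion: for every weighted graph $(\Gamma,h)$ and every linear ordering of $E$, $$Q_{(\Gamma,h)}(\mathbf u,v)=\sum_T(v+1)^{\epsilon(T)}\sum_{\mathrm{II}(T)\subseteq F\subseteq T}\ \prod_{B\in\pi(F)}u_{h(B)},$$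 where $T$ ranges over the maximal spanning forests of $\Gamma$ (the spanning trees, if $\Gamma$ is connected). Here $\epsilon(T)$ is the number of edges $e\notin T$ that are the largest edge of the unique circle in $T\cup\{e\}$, and $\mathrm{II}(T)$ is the set of edges $e\in T$ that are not the largest edge of $\operatorname{clos}(T)\setminus\operatorname{clos}(T\setminus e)$, where $\operatorname{clos}(S)$ consists of $S$ and all edges $e$ that lie in a circle contained in $S\cup\{e\}$ (a loop being a circle of length 1, and a pair of parallel links one of length 2). -/

import Mathlib

universe u w r

/-- The sum of a nonempty finite family in a commutative semigroup `W`, which need not have a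
neutral element: it is computed after adjoining one, see `coe_semigroupSum`. -/
noncomputable def semigroupSum {W : Type w} [AddCommSemigroup W] {ι : Type u}
    (s : Finset ι) (hs : s.Nonempty) (h : ι → W) : W :=
  WithZero.unzero (x := ∑ i ∈ s, (h i : WithZero W)) (by
    induction hs using Finset.Nonempty.cons_induction with
    | singleton a => simp
    | cons a s ha hs ih =>
      obtain ⟨k, hk⟩ := WithZero.ne_zero_iff_exists.1 ih
      rw [Finset.sum_cons, ← hk, ← WithZero.coe_add]
      exact WithZero.coe_ne_zero)

theorem coe_semigroupSum {W : Type w} [AddCommSemigroup W] {ι : Type u}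
    (s : Finset ι) (hs : s.Nonempty) (h : ι → W) :
    ((semigroupSum s hs h : W) : WithZero W) = ∑ i ∈ s, (h i : WithZero W) :=
  WithZero.coe_unzero _

/-- A finite graph, with loops and multiple edges permitted (and no half or loose edges), whose
vertices carry weights in `W`. -/
structure WeightedGraph (W : Type w) where
  /-- the vertices -/
  V : Type u
  /-- the edges -/
  E : Type u
  finV : Finite V
  finE : Finite E
  /-- the unordered pair of endpoints of an edge; the two coincide when the edge is a loop -/
  ends : E → Sym2 V
  /-- the vertex weights -/
  h : V → W

namespace WeightedGraph

noncomputable instance instFintypeV {W : Type w} (G : WeightedGraph.{u} W) : Fintype G.V :=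
  haveI := G.finV
  Fintype.ofFinite _

noncomputable instance instFintypeE {W : Type w} (G : WeightedGraph.{u} W) : Fintype G.E :=
  haveI := G.finE
  Fintype.ofFinite _

/-- An edge is a loop if its endpoints coincide. -/
def IsLoop {W : Type w} (G : WeightedGraph.{u} W) (e : G.E) : Prop := (G.ends e).IsDiag

/-- An edge is a link if its endpoints are distinct. -/
def IsLink {W : Type w} (G : WeightedGraph.{u} W) (e : G.E) : Prop := ¬ (G.ends e).IsDiag

/-- The adjacency of distinct vertices in the spanning subgraph `(V, S)`. -/
def spanning {W : Type w} (G : WeightedGraph.{u} W) (S : Set G.E) : SimpleGraph G.V :=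
  SimpleGraph.fromRel (fun a b => ∃ e ∈ S, G.ends e = s(a, b))

/-- `π(S)`, the partition of the vertex set into connected components of `(V, S)`; a component is
identified with its vertex set. -/
abbrev Part {W : Type w} (G : WeightedGraph.{u} W) (S : Set G.E) : Type u :=
  (G.spanning S).ConnectedComponent

/-- The class in `π(S)` of a vertex. -/
abbrev part {W : Type w} (G : WeightedGraph.{u} W) (S : Set G.E) (a : G.V) : G.Part S :=
  (G.spanning S).connectedComponentMk a

instance instFinitePart {W : Type w} (G : WeightedGraph.{u} W) (S : Set G.E) :
    Finite (G.Part S) :=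
  Finite.of_surjective (G.part S) Quot.mk_surjective

noncomputable instance instFintypePart {W : Type w} (G : WeightedGraph.{u} W) (S : Set G.E) :
    Fintype (G.Part S) := Fintype.ofFinite _

open Classical in
/-- The set of vertices in a class of `π(S)`. -/
noncomputable def block {W : Type w} (G : WeightedGraph.{u} W) (S : Set G.E) (B : G.Part S) :
    Finset G.V :=
  Finset.univ.filter (fun a => G.part S a = B)

open Classical in
theorem block_nonempty {W : Type w} (G : WeightedGraph.{u} W) (S : Set G.E) (B : G.Part S) :
    (G.block S B).Nonempty := by
  obtain ⟨a, ha⟩ := Quot.mk_surjective B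
  exact ⟨a, Finset.mem_filter.2 ⟨Finset.mem_univ a, ha⟩⟩

/-- `h(B)`, the semigroup sum of the weights of the vertices in a class `B` of `π(S)`. -/
noncomputable def blockWeight {W : Type w} [AddCommSemigroup W] (G : WeightedGraph.{u} W)
    (S : Set G.E) (B : G.Part S) : W :=
  semigroupSum (G.block S B) (G.block_nonempty S B) G.h

/-- Deletion of an edge set. -/
def delete {W : Type w} (G : WeightedGraph.{u} W) (S : Set G.E) : WeightedGraph.{u} W where
  V := G.V
  E := {e : G.E // e ∉ S}
  finV := G.finV
  finE := haveI := G.finE; inferInstance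
  ends e := G.ends e
  h := G.h

/-- Contraction of an edge set `S`: each class of `π(S)` is identified to a single vertex, whose
weight is the sum of the weights in the class, and `S` is deleted. -/
noncomputable def contract {W : Type w} [AddCommSemigroup W] (G : WeightedGraph.{u} W)
    (S : Set G.E) : WeightedGraph.{u} W where
  V := G.Part S
  E := {e : G.E // e ∉ S}
  finV := inferInstance
  finE := haveI := G.finE; inferInstance
  ends e := (G.ends e).map (G.part S)
  h := G.blockWeight S

/-- The connected component of `G` with vertex set `B`: the subgraph induced by `B`, with the
restricted weights. -/
def component {W : Type w} (G : WeightedGraph.{u} W) (B : G.Part Set.univ) :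
    WeightedGraph.{u} W where
  V := {a : G.V // G.part Set.univ a = B}
  E := {e : G.E // ∀ a ∈ G.ends e, G.part Set.univ a = B}
  finV := haveI := G.finV; inferInstance
  finE := haveI := G.finE; inferInstance
  ends e := (G.ends e).attachWith e.2
  h a := G.h a

/-- Isomorphism of weighted graphs. -/
structure Iso {W : Type w} (G H : WeightedGraph.{u} W) where
  vert : G.V ≃ H.V
  edge : G.E ≃ H.E
  ends_edge : ∀ e, H.ends (edge e) = (G.ends e).map vert
  h_vert : ∀ a, H.h (vert a) = G.h a

/-! ### The dichromatic polynomial -/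

/-- The polynomial ring `ℤ[𝐮, v]` with one variable `u_k` for each weight `k` (the variable
`some k`) and one more variable `v` (the variable `none`). -/
abbrev DPoly (W : Type w) : Type w := MvPolynomial (Option W) ℤ

/-- The variable `u_k`. -/
noncomputable def uVar {W : Type w} (k : W) : DPoly W := MvPolynomial.X (some k)

/-- The variable `v`. -/
noncomputable def vVar {W : Type w} : DPoly W := MvPolynomial.X none

/-- The substitution `u_k ↦ x k`, `v ↦ y`. -/
noncomputable def subst {W : Type w} {R : Type r} [CommRing R] (x : W → R) (y : R) :
    DPoly W →+* R :=
  (MvPolynomial.aeval (fun o : Option W => o.elim y x)).toRingHom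

/-- The weighted-graph dichromatic polynomial
`∑_{S ⊆ E} v ^ (|S| - n + c(S)) ∏_{B ∈ π(S)} u_{h(B)}`.  The exponent is never negative, so that
the natural-number subtraction in it is a true one. -/
noncomputable def dichromatic {W : Type w} [AddCommSemigroup W] (G : WeightedGraph.{u} W) :
    DPoly W :=
  ∑ S : Finset G.E,
    vVar ^ (S.card + Fintype.card (G.Part (S : Set G.E)) - Fintype.card G.V) *
      ∏ B : G.Part (S : Set G.E), uVar (G.blockWeight (S : Set G.E) B)

/-- The defining properties, for a function `f` on weighted graphs with values in a commutative
ring, where `x k` and `y` are the values in the ring that play the roles of `u_k` and `v`. -/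
structure TutteConditions {W : Type w} [AddCommSemigroup W] {R : Type r} [CommRing R]
    (f : WeightedGraph.{u} W → R) (x : W → R) (y : R) : Prop where
  /-- deletion-contraction of links -/
  additivity : ∀ (G : WeightedGraph.{u} W) (e : G.E), G.IsLink e →
    f G = f (G.delete {e}) + f (G.contract {e})
  /-- isomorphism invariance -/
  invariance : ∀ G H : WeightedGraph.{u} W, Nonempty (Iso G H) → f G = f H
  /-- the value on the empty graph -/
  unitarity : ∀ G : WeightedGraph.{u} W, IsEmpty G.V → f G = 1
  /-- the value on a graph without edges -/
  initial : ∀ G : WeightedGraph.{u} W, IsEmpty G.E → f G = ∏ a : G.V, x (G.h a)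
  /-- deletion of loops -/
  loop : ∀ (G : WeightedGraph.{u} W) (e : G.E), G.IsLoop e → f G = (y + 1) * f (G.delete {e})

/-! ### Spanning trees and activities -/

/-- A circle, as an edge set: the edges `e₀, …, eₙ` of a closed walk
`a₀ e₀ a₁ e₁ ⋯ aₙ eₙ a₀` without repeated vertices or edges.  A loop is a circle, and so is a pair
of parallel links.  The addition is cyclic. -/
def IsCircle {W : Type w} (G : WeightedGraph.{u} W) (C : Set G.E) : Prop :=
  ∃ (n : ℕ) (a : Fin (n + 1) → G.V) (e : Fin (n + 1) → G.E),
    Function.Injective a ∧ Function.Injective e ∧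
    (∀ i, G.ends (e i) = s(a i, a (i + 1))) ∧ C = Set.range e

/-- A spanning forest, as an edge set. -/
def IsForest {W : Type w} (G : WeightedGraph.{u} W) (F : Set G.E) : Prop :=
  ∀ C ⊆ F, ¬ G.IsCircle C

/-- A maximal spanning forest, as an edge set: one spanning tree in each component of the graph.
If the graph is connected, this is a spanning tree. -/
def IsSpanningTree {W : Type w} (G : WeightedGraph.{u} W) (T : Set G.E) : Prop :=
  Maximal G.IsForest T

/-- The closure of an edge set. -/
def clos {W : Type w} (G : WeightedGraph.{u} W) (S : Set G.E) : Set G.E :=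
  S ∪ {e | ∃ C, G.IsCircle C ∧ e ∈ C ∧ C ⊆ insert e S}

/-- The externally active edges with respect to `T`: those outside of `T` that are largest in the
circle which they form with edges of `T`. -/
def extActive {W : Type w} (G : WeightedGraph.{u} W) [LinearOrder G.E] (T : Set G.E) : Set G.E :=
  {e | e ∉ T ∧ ∃ C, G.IsCircle C ∧ C ⊆ insert e T ∧ IsGreatest C e}

/-- The internally active edges with respect to `T`: those edges `e` of `T` that are largest in
the fundamental cocircuit `clos T \ clos (T \ e)`. -/
def intActive {W : Type w} (G : WeightedGraph.{u} W) [LinearOrder G.E] (T : Set G.E) : Set G.E :=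
  {e | e ∈ T ∧ IsGreatest (G.clos T \ G.clos (T \ {e})) e}

/-- The internally inactive edges with respect to `T`. -/
def intInactive {W : Type w} (G : WeightedGraph.{u} W) [LinearOrder G.E] (T : Set G.E) :
    Set G.E :=
  T \ G.intActive T

open Classical in
/-- The spanning-tree expansion
`∑_T (v + 1) ^ ε(T) ∑_{II(T) ⊆ F ⊆ T} ∏_{B ∈ π(F)} u_{h(B)}` with respect to a linear ordering of
the edges. -/
noncomputable def treeExpansion {W : Type w} [AddCommSemigroup W] (G : WeightedGraph.{u} W)
    [LinearOrder G.E] : DPoly W :=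
  ∑ T ∈ Finset.univ.filter (fun T : Finset G.E => G.IsSpanningTree (T : Set G.E)),
    (vVar + 1) ^ (G.extActive (T : Set G.E)).ncard *
      ∑ F ∈ T.powerset.filter (fun F : Finset G.E => G.intInactive (T : Set G.E) ⊆ F),
        ∏ B : G.Part (F : Set G.E), uVar (G.blockWeight (F : Set G.E) B)

end WeightedGraph

/-! The term of an edge set `S` depends only on `|S|`, `|V|` and the weighted components of `(V,
S)`. Split the sum by whether `S` contains `e`. The sets without `e` give the sum for `Γ \ e`. For a
link, the sets with `e` give the sum for `Γ / e`: one edge and one vertex disappear, while the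
components and their weights survive. For a loop, they repeat the sum for `Γ \ e` with an extra
factor `v`. Universality follows because the conditions determine `f` by induction on the number of
edges and are preserved by ring homomorphisms. Multiplicativity holds because an edge set is a
family of edge sets, one in each component.

The tree expansion is Crapo's interval partition. `connClosure` is the closure operator of the
graphic matroid, and it agrees with the circle closure (`clos_eq_connClosure`). Each `S` lies in
exactly one interval `[II(T), T ∪ EA(T)]`, where `EA(T)` is the set of externally active edges
(`intervalTree_eq_iff`). Write `S = F ∪ A` with `F ⊆ T` and `A ⊆ EA(T)`. The edges of `A` are
spanned by `II(T) ⊆ F`, so `S` has the components of the forest `F` and its power of `v` is `v ^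
|A|` (`IsSpanningTree.dichromaticTerm_union`). Summing over `A` gives `(v + 1) ^ ε(T)`. -/

theorem exists_equiv_of_surjective {V A B : Type*} {p : V → A} {q : V → B}
    (hp : Function.Surjective p) (hq : Function.Surjective q)
    (hpq : ∀ a b, p a = p b ↔ q a = q b) : ∃ φ : A ≃ B, ∀ a, φ (p a) = q a := by
  have key : ∀ a, q (Function.surjInv hp (p a)) = q a := fun a =>
    (hpq (Function.surjInv hp (p a)) a).1 (Function.surjInv_eq hp (p a))
  refine ⟨Equiv.ofBijective (fun x => q (Function.surjInv hp x)) ⟨?_, ?_⟩, key⟩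
  · intro x y hxy
    have := (hpq _ _).2 hxy
    rwa [Function.surjInv_eq hp, Function.surjInv_eq hp] at this
  · intro z
    obtain ⟨a, rfl⟩ := hq z
    exact ⟨p a, key a⟩

theorem Finset.sum_filter_eq_self {ι M : Type*} [Fintype ι] [AddCommMonoid M] (b : ι)
    [∀ a, Decidable (a = b)] (g : ι → M) : ∑ a with a = b, g a = g b := by
  rw [Finset.sum_filter, Finset.sum_eq_single b] <;> simp +contextual

-- `F` plays the role of the edges other than `e`, so the two summands are the subsets without and
-- with `e`.
open Classical in
theorem Finset.sum_finset_eq_sum_of_range_eq {E F M : Type*} [Fintype E] [Fintype F]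
    [AddCommMonoid M] (e : E) (ι : F ↪ E) (hι : Set.range ι = {e}ᶜ) (g : Finset E → M) :
    ∑ S, g S = ∑ S : Finset F, (g (S.map ι) + g (insert e (S.map ι))) := by
  have he : Finset.univ.map ι = Finset.univ.erase e := by
    apply Finset.coe_injective
    simp [hι, Set.compl_eq_univ_sdiff]
  have h : ∀ g : Finset E → M, ∑ S ∈ (Finset.univ.erase e).powerset, g S =
      ∑ S : Finset F, g (S.map ι) := by
    intro g
    rw [← he]
    symm
    refine Finset.sum_bij (fun S _ => S.map ι) ?_ ?_ ?_ ?_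
    · intro S _
      simp
    · intro S _ S' _ h
      exact Finset.map_injective ι h
    · intro S hS
      obtain ⟨S', -, rfl⟩ := Finset.subset_map_iff.1 (Finset.mem_powerset.1 hS)
      exact ⟨S', Finset.mem_univ _, rfl⟩
    · simp
  rw [Finset.sum_add_distrib, ← h, ← h (fun S => g (insert e S)),
    ← Finset.sum_powerset_insert (Finset.notMem_erase e _),
    Finset.insert_erase (Finset.mem_univ e), Finset.powerset_univ]

theorem Sym2.isDiag_map_comp {α β γ : Type*} {f : α → β} {g : β → γ} {z : Sym2 α} :
    (z.map (fun a => g (f a))).IsDiag ↔ ((z.map f).map g).IsDiag := by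
  rw [Sym2.map_map]; rfl

namespace WeightedGraph

variable {W : Type w}

/-! ### The closure operator given by connectedness -/

section Closure

variable (G : WeightedGraph.{u} W)

/-- The edges whose endpoints lie in the same connected component of `(V, S)`. -/
def connClosure (S : Set G.E) : Set G.E := {e | ((G.ends e).map (G.part S)).IsDiag}

variable {G}

theorem mem_connClosure_iff {S : Set G.E} {e : G.E} {a b : G.V} (h : G.ends e = s(a, b)) :
    e ∈ G.connClosure S ↔ G.part S a = G.part S b := by
  simp [connClosure, h]

theorem part_surjective (S : Set G.E) : Function.Surjective (G.part S) := Quot.mk_surjective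

theorem exists_ends (e : G.E) : ∃ a b, G.ends e = s(a, b) := by
  induction h : G.ends e with | _ a b => exact ⟨a, b, rfl⟩

theorem subset_connClosure (S : Set G.E) : S ⊆ G.connClosure S := by
  intro e he
  obtain ⟨a, b, hab⟩ := exists_ends e
  rw [mem_connClosure_iff hab]
  by_cases h : a = b
  · rw [h]
  · exact SimpleGraph.ConnectedComponent.sound
      (SimpleGraph.Adj.reachable ⟨h, Or.inl ⟨e, he, hab⟩⟩)

/-- Induction along a walk. Comparisons of components below reduce to this by choosing `f` to be
another class map and checking single edges. -/
theorem eq_of_part_eq {α : Type*} {S : Set G.E} (f : G.V → α)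
    (hf : ∀ e ∈ S, ((G.ends e).map f).IsDiag) {a b : G.V} (h : G.part S a = G.part S b) :
    f a = f b := by
  obtain ⟨p⟩ := SimpleGraph.ConnectedComponent.exact h
  induction p with
  | nil => rfl
  | cons hadj p ih =>
    rw [← ih (SimpleGraph.ConnectedComponent.sound p.reachable)]
    obtain ⟨-, ⟨e, he, h⟩ | ⟨e, he, h⟩⟩ := hadj
    · simpa [h] using hf e he
    · simpa [h, eq_comm] using hf e he

theorem part_eq_of_subset_connClosure {S S' : Set G.E} (hS : S' ⊆ G.connClosure S) {a b : G.V}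
    (h : G.part S' a = G.part S' b) : G.part S a = G.part S b :=
  eq_of_part_eq (G.part S) (fun _ he => hS he) h

theorem part_mono {S S' : Set G.E} (hS : S' ⊆ S) {a b : G.V}
    (h : G.part S' a = G.part S' b) : G.part S a = G.part S b :=
  part_eq_of_subset_connClosure (hS.trans (subset_connClosure S)) h

theorem connClosure_subset {S S' : Set G.E} (hS : S' ⊆ G.connClosure S) :
    G.connClosure S' ⊆ G.connClosure S := by
  intro e he
  obtain ⟨a, b, hab⟩ := exists_ends e
  rw [mem_connClosure_iff hab] at he ⊢
  exact part_eq_of_subset_connClosure hS he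

theorem connClosure_mono {S S' : Set G.E} (hS : S' ⊆ S) : G.connClosure S' ⊆ G.connClosure S :=
  connClosure_subset (hS.trans (subset_connClosure S))

theorem mem_connClosure_of_subset {S S' : Set G.E} {e : G.E} (hS : S' ⊆ S)
    (he : e ∈ G.connClosure S') : e ∈ G.connClosure S := connClosure_mono hS he

theorem IsLoop.mem_connClosure {e : G.E} (he : G.IsLoop e) (S : Set G.E) :
    e ∈ G.connClosure S := by
  obtain ⟨a, b, hab⟩ := exists_ends e
  rw [mem_connClosure_iff hab]
  rw [IsLoop, hab] at he
  rw [Sym2.mk_isDiag_iff.1 he]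

theorem part_empty_injective : Function.Injective (G.part ∅) := fun _ _ h =>
  eq_of_part_eq id (by simp) h

-- Adding `f = pq` merges the class of `q` into that of `p` and does nothing else: the merging map
-- is constant along `f` and along every edge of `S`.
open Classical in
theorem merge_eq_of_part_insert_eq {S : Set G.E} {f : G.E} {p q a b : G.V}
    (hf : G.ends f = s(p, q)) (h : G.part (insert f S) a = G.part (insert f S) b) :
    (if G.part S a = G.part S q then G.part S p else G.part S a) =
      (if G.part S b = G.part S q then G.part S p else G.part S b) := by
  refine eq_of_part_eq
    (fun a => if G.part S a = G.part S q then G.part S p else G.part S a) ?_ h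
  rintro e (rfl | he)
  · rw [hf]; simp
  · obtain ⟨c, d, hcd⟩ := exists_ends e
    have := (mem_connClosure_iff hcd).1 (subset_connClosure S he)
    rw [hcd, Sym2.map_mk, Sym2.mk_isDiag_iff, this]

/-- The exchange axiom of the graphic matroid. If `f` is what joins the ends of `e`, then one end of
`e` is in the class of `p` and the other in that of `q`, so `e` joins these classes as well. -/
theorem connClosure_exchange {S : Set G.E} {e f : G.E} (he : e ∈ G.connClosure (insert f S))
    (he' : e ∉ G.connClosure S) : f ∈ G.connClosure (insert e S) := by
  classical
  obtain ⟨a, b, hab⟩ := exists_ends e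
  obtain ⟨p, q, hpq⟩ := exists_ends f
  rw [mem_connClosure_iff hab] at he he'
  rw [mem_connClosure_iff hpq]
  have h := merge_eq_of_part_insert_eq hpq he
  have hab' := (mem_connClosure_iff hab).1 (subset_connClosure _ (Set.mem_insert e S))
  have mono : ∀ {c d}, G.part S c = G.part S d →
      G.part (insert e S) c = G.part (insert e S) d := part_mono (Set.subset_insert e S)
  split_ifs at h with h1 h2 h2
  · exact absurd (h1.trans h2.symm) he'
  · rw [mono h, ← hab', mono h1]
  · rw [← mono h, hab', mono h2]
  · exact absurd h he'

-- The new classes are represented by the old classes other than that of `q`, which is absorbed by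
-- the class of `p`.
open Classical in
theorem card_part_insert {S : Set G.E} {f : G.E} (hf : f ∉ G.connClosure S) :
    Fintype.card (G.Part (insert f S)) + 1 = Fintype.card (G.Part S) := by
  obtain ⟨p, q, hpq⟩ := exists_ends f
  rw [mem_connClosure_iff hpq] at hf
  have hpq' := (mem_connClosure_iff hpq).1 (subset_connClosure _ (Set.mem_insert f S))
  obtain ⟨φ, -⟩ := exists_equiv_of_surjective (V := {a : G.V // G.part S a ≠ G.part S q})
    (p := fun a => (⟨G.part S a, a.2⟩ : {x : G.Part S // x ≠ G.part S q}))
    (q := fun a => G.part (insert f S) a.1)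
    (by
      rintro ⟨x, hx⟩
      obtain ⟨a, rfl⟩ := part_surjective S x
      exact ⟨⟨a, hx⟩, rfl⟩)
    (by
      intro x
      obtain ⟨a, rfl⟩ := part_surjective _ x
      by_cases ha : G.part S a = G.part S q
      · exact ⟨⟨p, hf⟩, hpq'.trans (part_mono (Set.subset_insert f S) ha).symm⟩
      · exact ⟨⟨a, ha⟩, rfl⟩)
    (by
      rintro ⟨a, ha⟩ ⟨b, hb⟩
      simp only [Subtype.mk.injEq]
      refine ⟨part_mono (Set.subset_insert f S), fun h => ?_⟩
      simpa [ha, hb] using merge_eq_of_part_insert_eq hpq h)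
  rw [← Fintype.card_congr φ, Fintype.card_subtype_compl, Fintype.card_subtype_eq]
  have : 0 < Fintype.card (G.Part S) := Fintype.card_pos_iff.2 ⟨G.part S p⟩
  omega

theorem card_part_congr {S S' : Set G.E} (h : ∀ a b, G.part S a = G.part S b ↔
    G.part S' a = G.part S' b) : Fintype.card (G.Part S) = Fintype.card (G.Part S') := by
  obtain ⟨φ, -⟩ := exists_equiv_of_surjective (part_surjective S) (part_surjective S') h
  exact Fintype.card_congr φ

theorem part_insert_eq_iff {S : Set G.E} {e : G.E} (he : e ∈ G.connClosure S) (a b : G.V) :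
    G.part (insert e S) a = G.part (insert e S) b ↔ G.part S a = G.part S b :=
  ⟨part_eq_of_subset_connClosure (Set.insert_subset he (subset_connClosure S)),
    part_mono (Set.subset_insert e S)⟩

theorem card_part_empty : Fintype.card (G.Part ∅) = Fintype.card G.V :=
  (Fintype.card_of_bijective ⟨part_empty_injective, part_surjective _⟩).symm

/-- Each new edge lowers the number of components by at most one. Hence the natural subtraction in
the exponent of `v` is never truncated. -/
theorem card_le_card_add_card_part (S : Finset G.E) :
    Fintype.card G.V ≤ S.card + Fintype.card (G.Part (S : Set G.E)) := by
  classical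
  induction S using Finset.induction_on with
  | empty => rw [Finset.coe_empty, card_part_empty]; simp
  | insert e S he ih =>
    rw [Finset.coe_insert, Finset.card_insert_of_notMem he]
    by_cases h : e ∈ G.connClosure (S : Set G.E)
    · rw [card_part_congr (part_insert_eq_iff h)]; omega
    · have := card_part_insert h; omega

/-- The edges of a deletion, as edges of the graph. -/
def deleteEdge (X : Set G.E) : (G.delete X).E ↪ G.E := Function.Embedding.subtype _

theorem range_deleteEdge (X : Set G.E) : Set.range (deleteEdge X) = Xᶜ :=
  Subtype.range_val

theorem part_delete_iff (X : Set G.E) (S : Set (G.delete X).E) (a b : G.V) :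
    G.part (deleteEdge X '' S) a = G.part (deleteEdge X '' S) b ↔
      (G.delete X).part S a = (G.delete X).part S b := by
  constructor
  · intro h
    refine eq_of_part_eq (G := G) ((G.delete X).part S) ?_ h
    rintro _ ⟨e, he, rfl⟩
    exact subset_connClosure (G := G.delete X) S he
  · intro h
    refine eq_of_part_eq (G := G.delete X) (G.part (deleteEdge X '' S)) ?_ h
    intro e he
    exact subset_connClosure (G := G) _ ⟨e, he, rfl⟩

theorem card_delete_edges_lt (e : G.E) :
    Nat.card (G.delete {e}).E < Nat.card G.E :=
  haveI := G.finE
  Finite.card_subtype_lt (p := fun x => x ∉ ({e} : Set G.E)) (x := e) (by simp)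

end Closure

/-! ### Block weights and the terms of the polynomial -/

section Weights

variable [AddCommSemigroup W]

open Classical in
theorem coe_blockWeight (G : WeightedGraph.{u} W) (S : Set G.E) (B : G.Part S) :
    ((G.blockWeight S B : W) : WithZero W) = ∑ a with G.part S a = B, (G.h a : WithZero W) :=
  coe_semigroupSum _ _ _

variable {G H : WeightedGraph.{u} W}

-- A single comparison principle for deletion (`f` the identity), contraction (`f` the class map)
-- and isomorphism. Weights are summed along the fibres of `f`, so a block sum downstairs is a
-- double sum that reassembles the block sum upstairs.
open Classical in
theorem exists_part_equiv {S : Set G.E} {S' : Set H.E} (f : G.V → H.V)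
    (hf : Function.Surjective f)
    (hpart : ∀ a b, G.part S a = G.part S b ↔ H.part S' (f a) = H.part S' (f b))
    (hh : ∀ b, (H.h b : WithZero W) = ∑ a with f a = b, (G.h a : WithZero W)) :
    ∃ φ : G.Part S ≃ H.Part S', ∀ B, G.blockWeight S B = H.blockWeight S' (φ B) := by
  obtain ⟨φ, hφ⟩ := exists_equiv_of_surjective (part_surjective S)
    ((part_surjective S').comp hf) hpart
  refine ⟨φ, fun B => WithZero.coe_injective ?_⟩
  rw [coe_blockWeight, coe_blockWeight, Finset.sum_congr rfl (fun b _ => hh b),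
    Finset.sum_sigma']
  refine Finset.sum_bij' (fun a _ => ⟨f a, a⟩) (fun x _ => x.2) ?_ ?_ ?_ ?_ ?_
  · intro a ha
    have : G.part S a = B := by simpa using ha
    simp [← this, hφ]
  · rintro ⟨b, a⟩ h
    simp only [Finset.mem_sigma, Finset.mem_filter, Finset.mem_univ, true_and] at h ⊢
    apply φ.injective
    rw [hφ, ← h.1, ← h.2]; rfl
  · simp
  · rintro ⟨b, a⟩ h
    simp only [Finset.mem_sigma, Finset.mem_filter, Finset.mem_univ, true_and] at h ⊢
    simp [h.2]
  · simp

/-- The contribution `∏_{B ∈ π(S)} u_{h(B)}` of an edge set to the dichromatic polynomial. -/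
noncomputable def partMonomial (G : WeightedGraph.{u} W) (S : Set G.E) : DPoly W :=
  ∏ B : G.Part S, uVar (G.blockWeight S B)

/-- The term of the dichromatic polynomial that belongs to an edge set. -/
noncomputable def dichromaticTerm (G : WeightedGraph.{u} W) (S : Finset G.E) : DPoly W :=
  vVar ^ (S.card + Fintype.card (G.Part (S : Set G.E)) - Fintype.card G.V) *
    G.partMonomial (S : Set G.E)

theorem dichromatic_eq_sum (G : WeightedGraph.{u} W) :
    G.dichromatic = ∑ S : Finset G.E, G.dichromaticTerm S := rfl

open Classical in
theorem card_part_eq_and_partMonomial_eq {S : Set G.E} {S' : Set H.E} (f : G.V → H.V)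
    (hf : Function.Surjective f)
    (hpart : ∀ a b, G.part S a = G.part S b ↔ H.part S' (f a) = H.part S' (f b))
    (hh : ∀ b, (H.h b : WithZero W) = ∑ a with f a = b, (G.h a : WithZero W)) :
    Fintype.card (G.Part S) = Fintype.card (H.Part S') ∧
      G.partMonomial S = H.partMonomial S' := by
  obtain ⟨φ, hφ⟩ := exists_part_equiv f hf hpart hh
  exact ⟨Fintype.card_congr φ, Fintype.prod_equiv φ _ _ fun B => by rw [hφ]⟩

theorem partMonomial_congr {S S' : Set G.E} (h : ∀ a b, G.part S a = G.part S b ↔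
    G.part S' a = G.part S' b) : G.partMonomial S = G.partMonomial S' := by
  classical
  refine (card_part_eq_and_partMonomial_eq id Function.surjective_id h ?_).2
  exact fun b => (Finset.sum_filter_eq_self b fun a => (G.h a : WithZero W)).symm

end Weights

/-! ### Deletion, contraction, loops and universality -/

section DeletionContraction

variable [AddCommSemigroup W] {G : WeightedGraph.{u} W}

/-- The edges of a contraction, as edges of the graph. -/
def contractEdge (X : Set G.E) : (G.contract X).E ↪ G.E := Function.Embedding.subtype _

theorem part_contract_iff (X : Set G.E) (S : Set (G.contract X).E) (a b : G.V) :
    G.part (X ∪ contractEdge X '' S) a = G.part (X ∪ contractEdge X '' S) b ↔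
      (G.contract X).part S (G.part X a) = (G.contract X).part S (G.part X b) := by
  constructor
  · intro h
    refine eq_of_part_eq (G := G) (fun a => (G.contract X).part S (G.part X a)) ?_ h
    rintro _ (he | ⟨e, he, rfl⟩)
    · exact Sym2.isDiag_map_comp.2 (Sym2.IsDiag.map (subset_connClosure X he))
    · exact Sym2.isDiag_map_comp.2 (subset_connClosure (G := G.contract X) S he)
  · intro h
    -- Replacing a vertex by the chosen representative of its class in `π(X)` does not change its
    -- component, so the component map descends to the contraction.
    have key : ∀ a, G.part (X ∪ contractEdge X '' S) (Quot.out (G.part X a)) =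
        G.part (X ∪ contractEdge X '' S) a := fun a =>
      part_mono Set.subset_union_left (Quot.out_eq (G.part X a))
    have := eq_of_part_eq (G := G.contract X)
      (fun B : G.Part X => G.part (X ∪ contractEdge X '' S) (Quot.out B)) ?_ h
    · rwa [key, key] at this
    · intro e he
      have h1 := subset_connClosure (G := G) (X ∪ contractEdge X '' S) (Or.inr ⟨e, he, rfl⟩)
      refine (Sym2.isDiag_map_comp (f := G.part X) (g := fun B : G.Part X =>
        G.part (X ∪ contractEdge X '' S) (Quot.out B))).1 ?_
      rwa [funext key]

theorem dichromaticTerm_delete (X : Set G.E) (S : Finset (G.delete X).E) :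
    G.dichromaticTerm (S.map (deleteEdge X)) = (G.delete X).dichromaticTerm S := by
  classical
  obtain ⟨h1, h2⟩ := card_part_eq_and_partMonomial_eq (G := G) (H := G.delete X)
    (S := deleteEdge X '' (S : Set (G.delete X).E)) (S' := S) id Function.surjective_id
    (part_delete_iff X _) (fun b => (Finset.sum_filter_eq_self (ι := G.V) b fun a => (G.h a : WithZero W)).symm)
  rw [dichromaticTerm, dichromaticTerm, Finset.coe_map, h2, h1, Finset.card_map]
  rfl

-- The edge set gains `e` and the graph has one vertex more than its contraction; the two effects
-- cancel in the exponent. A link is needed for the vertex count to drop.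
open Classical in
theorem dichromaticTerm_contract {e : G.E} (he : G.IsLink e) (S : Finset (G.contract {e}).E) :
    G.dichromaticTerm (insert e (S.map (contractEdge {e}))) =
      (G.contract {e}).dichromaticTerm S := by
  obtain ⟨h1, h2⟩ := card_part_eq_and_partMonomial_eq (G := G) (H := G.contract {e})
    (S := {e} ∪ contractEdge {e} '' (S : Set (G.contract {e}).E)) (S' := S) (G.part {e})
    (part_surjective _) (part_contract_iff {e} _) (fun B => coe_blockWeight G {e} B)
  have h4 : Fintype.card (G.contract {e}).V + 1 = Fintype.card G.V := by
    rw [← card_part_empty (G := G), ← card_part_insert (G := G) (S := ∅) (f := e),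
      ← LawfulSingleton.insert_empty_eq]
    · congr 1
    · obtain ⟨a, b, hab⟩ := exists_ends e
      rw [mem_connClosure_iff hab, part_empty_injective.eq_iff]
      rwa [IsLink, hab, Sym2.mk_isDiag_iff] at he
  have h5 : e ∉ S.map (contractEdge {e}) := fun h => by
    obtain ⟨x, -, hx⟩ := Finset.mem_map.1 h
    exact x.2 hx
  rw [dichromaticTerm, dichromaticTerm, Finset.coe_insert, Finset.coe_map, Set.insert_eq, h2, h1,
    Finset.card_insert_of_notMem h5, Finset.card_map]
  congr 2
  omega

open Classical in
theorem dichromaticTerm_insert_loop {e : G.E} (he : G.IsLoop e) {S : Finset G.E} (heS : e ∉ S) :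
    G.dichromaticTerm (insert e S) = vVar * G.dichromaticTerm S := by
  have h := part_insert_eq_iff (he.mem_connClosure (S : Set G.E))
  rw [dichromaticTerm, dichromaticTerm, Finset.coe_insert, card_part_congr h,
    partMonomial_congr h, Finset.card_insert_of_notMem heS, ← mul_assoc, ← pow_succ']
  congr 2
  -- The exponent grows by exactly one only because the subtraction is not truncated.
  have := card_le_card_add_card_part S
  omega

theorem dichromatic_of_isLink {e : G.E} (he : G.IsLink e) :
    G.dichromatic = (G.delete {e}).dichromatic + (G.contract {e}).dichromatic := by
  classical
  have h1 : (G.delete {e}).dichromatic =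
      ∑ S : Finset (G.delete {e}).E, G.dichromaticTerm (S.map (deleteEdge {e})) :=
    Finset.sum_congr rfl fun S _ => (dichromaticTerm_delete {e} S).symm
  -- Deletion and contraction have definitionally the same edge type, so both sums may be indexed by
  -- the edge sets of the deletion.
  have h2 : (G.contract {e}).dichromatic =
      ∑ S : Finset (G.delete {e}).E, G.dichromaticTerm (insert e (S.map (deleteEdge {e}))) :=
    Finset.sum_congr rfl fun S _ => (dichromaticTerm_contract he S).symm
  rw [dichromatic_eq_sum G, Finset.sum_finset_eq_sum_of_range_eq e _ (range_deleteEdge {e}),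
    Finset.sum_add_distrib, h1, h2]

theorem dichromatic_of_isLoop {e : G.E} (he : G.IsLoop e) :
    G.dichromatic = (vVar + 1) * (G.delete {e}).dichromatic := by
  classical
  rw [dichromatic_eq_sum G, Finset.sum_finset_eq_sum_of_range_eq e _ (range_deleteEdge {e}),
    dichromatic_eq_sum, Finset.mul_sum]
  refine Finset.sum_congr rfl fun S _ => ?_
  have h : e ∉ S.map (deleteEdge {e}) := fun h => by
    obtain ⟨x, -, hx⟩ := Finset.mem_map.1 h
    exact x.2 hx
  rw [dichromaticTerm_insert_loop he h, dichromaticTerm_delete]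
  ring

theorem dichromatic_congr {G H : WeightedGraph.{u} W} (φ : Iso G H) :
    G.dichromatic = H.dichromatic := by
  classical
  rw [dichromatic_eq_sum, dichromatic_eq_sum]
  refine Fintype.sum_equiv φ.edge.finsetCongr _ _ fun S => ?_
  obtain ⟨h1, h2⟩ := card_part_eq_and_partMonomial_eq (G := G) (H := H) (S := S)
    (S' := φ.edge '' S) φ.vert φ.vert.surjective (by
      intro a b
      constructor
      · intro h
        refine eq_of_part_eq (G := G) (fun a => H.part (φ.edge '' S) (φ.vert a)) ?_ h
        intro e he
        have := subset_connClosure (φ.edge '' S) (Set.mem_image_of_mem φ.edge he)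
        rwa [connClosure, Set.mem_ofPred_eq, φ.ends_edge, Sym2.map_map] at this
      · intro h
        have := eq_of_part_eq (G := H) (fun a => G.part S (φ.vert.symm a)) ?_ h
        · simpa using this
        · rintro _ ⟨e, he, rfl⟩
          rw [φ.ends_edge, Sym2.map_map]
          have := subset_connClosure (S : Set G.E) he
          rw [connClosure, Set.mem_ofPred_eq] at this
          convert this using 3
          simp) (by
      intro b
      obtain ⟨a, rfl⟩ := φ.vert.surjective b
      simp [φ.h_vert, Finset.sum_filter_eq_self])
  have h3 : ((φ.edge.finsetCongr S : Finset H.E) : Set H.E) = φ.edge '' S := by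
    simp [Equiv.finsetCongr_apply]
  rw [dichromaticTerm, dichromaticTerm, h3, h2, h1, Fintype.card_congr φ.vert]
  simp [Equiv.finsetCongr_apply]

theorem dichromatic_of_isEmpty_edges [IsEmpty G.E] : G.dichromatic = ∏ a, uVar (G.h a) := by
  classical
  rw [dichromatic_eq_sum, Fintype.sum_unique, dichromaticTerm]
  have h0 : ((default : Finset G.E) : Set G.E) = ∅ := Set.eq_empty_of_isEmpty _
  have hc : (default : Finset G.E).card = 0 := by
    rw [Finset.card_eq_zero]; exact Finset.eq_empty_of_isEmpty _
  rw [h0, hc, card_part_empty]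
  simp only [zero_add, Nat.sub_self, pow_zero, one_mul, partMonomial]
  symm
  refine Fintype.prod_bijective (G.part ∅) ⟨part_empty_injective, part_surjective _⟩ _ _ ?_
  intro a
  congr 1
  apply WithZero.coe_injective
  rw [coe_blockWeight]
  simp [part_empty_injective.eq_iff, Finset.sum_filter_eq_self, -SimpleGraph.ConnectedComponent.eq]

theorem tutteConditions_dichromatic :
    TutteConditions (fun G : WeightedGraph.{u} W => G.dichromatic) uVar vVar where
  additivity _ _ he := dichromatic_of_isLink he
  invariance _ _ h := h.elim dichromatic_congr
  unitarity G hV := by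
    have : IsEmpty G.E := ⟨fun e => by
      obtain ⟨a, -⟩ := exists_ends e
      exact hV.false a⟩
    simp [dichromatic_of_isEmpty_edges]
  initial _ _ := dichromatic_of_isEmpty_edges
  loop _ _ he := dichromatic_of_isLoop he

/-- Any edge is a loop or a link, and either way its condition reduces to graphs with fewer edges.
-/
theorem TutteConditions.ext {R : Type r} [CommRing R] {f g : WeightedGraph.{u} W → R}
    {x : W → R} {y : R} (hf : TutteConditions f x y) (hg : TutteConditions g x y)
    (G : WeightedGraph.{u} W) : f G = g G := by
  induction hn : Nat.card G.E using Nat.strong_induction_on generalizing G with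
  | _ n ih =>
    subst hn
    by_cases hE : IsEmpty G.E
    · rw [hf.initial G hE, hg.initial G hE]
    · obtain ⟨e⟩ := not_isEmpty_iff.1 hE
      have hlt := card_delete_edges_lt e
      by_cases he : G.IsLoop e
      · rw [hf.loop G e he, hg.loop G e he, ih _ hlt _ rfl]
      · rw [hf.additivity G e he, hg.additivity G e he, ih _ hlt _ rfl,
          ih (Nat.card (G.contract {e}).E) hlt _ rfl]

theorem TutteConditions.map {R : Type*} {R' : Type*} [CommRing R] [CommRing R']
    {f : WeightedGraph.{u} W → R} {x : W → R} {y : R} (hf : TutteConditions f x y)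
    (ψ : R →+* R') : TutteConditions (fun G => ψ (f G)) (fun k => ψ (x k)) (ψ y) where
  additivity G e he := by rw [hf.additivity G e he, map_add]
  invariance G H h := by rw [hf.invariance G H h]
  unitarity G h := by rw [hf.unitarity G h, map_one]
  initial G h := by rw [hf.initial G h, map_prod]
  loop G e he := by rw [hf.loop G e he]; simp

theorem tutteConditions_subst {R : Type r} [CommRing R] (x : W → R) (y : R) :
    TutteConditions (fun G : WeightedGraph.{u} W => subst x y G.dichromatic) x y := by
  simpa [subst, uVar, vVar] using tutteConditions_dichromatic.map (subst x y)

theorem tutteConditions_iff {R : Type r} [CommRing R] (f : WeightedGraph.{u} W → R)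
    (x : W → R) (y : R) :
    TutteConditions f x y ↔ ∀ G, f G = subst x y G.dichromatic :=
  ⟨fun hf => hf.ext (tutteConditions_subst x y), fun h => by
    rw [funext h]; exact tutteConditions_subst x y⟩

end DeletionContraction

/-! ### Circles, forests and the graphic matroid -/

section Circles

variable {G : WeightedGraph.{u} W}

theorem IsCircle.mem_connClosure {C : Set G.E} (hC : G.IsCircle C) {f : G.E} (hf : f ∈ C) :
    f ∈ G.connClosure (C \ {f}) := by
  obtain ⟨n, a, e, -, he, hends, rfl⟩ := hC
  obtain ⟨j, rfl⟩ := hf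
  -- Walk around the circle from `a (j + 1)`, away from `e j`; after `n` steps the walk arrives at
  -- `a j`.
  have key : ∀ k ≤ n, G.part (Set.range e \ {e j}) (a (j + 1)) =
      G.part (Set.range e \ {e j}) (a (j + 1 + Fin.ofNat (n + 1) k)) := by
    intro k
    induction k with
    | zero => simp
    | succ k ih =>
      intro hk
      rw [ih (by omega)]
      -- Returning to index `j` would require `n + 1` to divide `k + 1`, which is at most `n`.
      have hne : j + 1 + Fin.ofNat (n + 1) k ≠ j := by
        intro h
        rw [add_assoc, add_eq_left] at h
        have := congrArg Fin.val h
        rw [Fin.val_add] at this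
        simp at this
        rw [← Nat.dvd_iff_mod_eq_zero] at this
        exact absurd (Nat.le_of_dvd (by omega) this) (by omega)
      have h1 := (mem_connClosure_iff (hends (j + 1 + Fin.ofNat (n + 1) k))).1
        (subset_connClosure (Set.range e \ {e j}) ⟨⟨_, rfl⟩, fun h => hne (he h)⟩)
      rw [h1]
      congr 2
      rw [add_assoc]
      congr 1
      apply Fin.ext
      rw [Fin.val_add]
      simp
  rw [mem_connClosure_iff (hends j), eq_comm, key n le_rfl]
  congr 2
  rw [add_assoc, add_eq_left]
  apply Fin.ext
  rw [Fin.val_add]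
  simp [add_comm]

/-- A path in `S` between the ends of `e` is closed up by `e`, placed at the last index. A path of
length zero yields a loop. -/
theorem exists_isCircle_of_mem_connClosure {S : Set G.E} {e : G.E} (heS : e ∉ S)
    (he : e ∈ G.connClosure S) : ∃ C, G.IsCircle C ∧ e ∈ C ∧ C ⊆ insert e S := by
  obtain ⟨x, y, hxy⟩ := exists_ends e
  rw [mem_connClosure_iff hxy] at he
  obtain ⟨p, hp⟩ := (SimpleGraph.ConnectedComponent.exact he).exists_isPath
  have hadj : ∀ i < p.length, ∃ f ∈ S, G.ends f = s(p.getVert i, p.getVert (i + 1)) := by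
    intro i hi
    obtain ⟨-, h | ⟨f, hf, h⟩⟩ := p.adj_getVert_succ hi
    · exact h
    · exact ⟨f, hf, by rw [h, Sym2.eq_swap]⟩
  have : Nonempty G.E := ⟨e⟩
  choose! g hgS hg using hadj
  have hinj : ∀ i ≤ p.length, ∀ j ≤ p.length, p.getVert i = p.getVert j → i = j :=
    fun i hi j hj h => hp.getVert_injOn hi hj h
  refine ⟨_, ⟨p.length, fun i => p.getVert i, fun i => if (i : ℕ) < p.length then g i else e,
    ?_, ?_, ?_, rfl⟩, ?_, ?_⟩
  · intro i j h
    exact Fin.ext (hinj _ (by omega) _ (by omega) h)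
  · intro i j h
    simp only at h
    split_ifs at h with h1 h2 h2
    · have h3 := hg i h1
      rw [h, hg j h2, Sym2.eq_iff] at h3
      obtain ⟨h3, -⟩ | ⟨h3, h4⟩ := h3
      · exact Fin.ext (hinj _ (by omega) _ (by omega) h3.symm)
      · have := hinj _ (by omega) _ (by omega) h3
        -- An edge traversed in opposite directions would force both `j = i + 1` and `i = j + 1`.
        have := hinj _ (by omega) _ (by omega) h4
        omega
    · exact absurd (h ▸ hgS i h1) heS
    · exact absurd (h ▸ hgS j h2) heS
    · apply Fin.ext; omega
  · intro i
    by_cases h : (i : ℕ) < p.length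
    · simp only [h, if_true]
      rw [hg i h, Fin.val_add_one_of_lt (Fin.lt_def.2 (by simpa using h))]
    · obtain rfl : i = Fin.last p.length := Fin.ext (by simp; omega)
      simp [hxy, Sym2.eq_swap]
  · exact ⟨Fin.last _, by simp⟩
  · rintro _ ⟨i, rfl⟩
    by_cases h : (i : ℕ) < p.length
    · simp only [h, if_true]
      exact Or.inr (hgS i h)
    · simp [h]

theorem clos_eq_connClosure (S : Set G.E) : G.clos S = G.connClosure S := by
  ext e
  constructor
  · rintro (he | ⟨C, hC, heC, hCS⟩)
    · exact subset_connClosure S he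
    · refine mem_connClosure_of_subset ?_ (hC.mem_connClosure heC)
      rintro f ⟨hf, hfe⟩
      exact (hCS hf).resolve_left hfe
  · intro he
    by_cases h : e ∈ S
    · exact Or.inl h
    · exact Or.inr (exists_isCircle_of_mem_connClosure h he)

/-- Turns the absence of circles into matroid independence, so that later arguments need only the
closure operator. -/
theorem isForest_iff {F : Set G.E} :
    G.IsForest F ↔ ∀ e ∈ F, e ∉ G.connClosure (F \ {e}) := by
  constructor
  · intro hF e he hcl
    obtain ⟨C, hC, -, hCF⟩ := exists_isCircle_of_mem_connClosure (by simp) hcl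
    refine hF C ?_ hC
    rwa [Set.insert_sdiff_singleton, Set.insert_eq_of_mem he] at hCF
  · intro h C hCF hC
    obtain ⟨e, he⟩ : C.Nonempty := by
      obtain ⟨n, a, e, -, -, -, rfl⟩ := hC
      exact Set.range_nonempty e
    exact h e (hCF he) (mem_connClosure_of_subset (Set.sdiff_subset_sdiff_left hCF)
      (hC.mem_connClosure he))

theorem IsForest.mono {F F' : Set G.E} (hF : G.IsForest F) (h : F' ⊆ F) : G.IsForest F' :=
  fun C hC => hF C (hC.trans h)

theorem IsForest.insert_of_notMem {F : Set G.E} (hF : G.IsForest F) {e : G.E}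
    (he : e ∉ G.connClosure F) : G.IsForest (insert e F) := by
  have heF : e ∉ F := fun h => he (subset_connClosure F h)
  rw [isForest_iff] at hF ⊢
  rintro f (rfl | hf) hcl
  · refine he (mem_connClosure_of_subset ?_ hcl)
    simp
  · have hne : e ≠ f := fun h => heF (h ▸ hf)
    rw [← Set.insert_sdiff_singleton_comm hne] at hcl
    have := connClosure_exchange hcl (hF f hf)
    rw [Set.insert_sdiff_singleton, Set.insert_eq_of_mem hf] at this
    exact he this

theorem isSpanningTree_iff {T : Set G.E} :
    G.IsSpanningTree T ↔ G.IsForest T ∧ ∀ e, e ∈ G.connClosure T := by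
  constructor
  · intro hT
    refine ⟨hT.prop, fun e => ?_⟩
    by_contra he
    exact he (subset_connClosure T (hT.le_of_ge (hT.prop.insert_of_notMem he)
      (Set.subset_insert e T) (Set.mem_insert e T)))
  · rintro ⟨hT, hcl⟩
    refine ⟨hT, fun F hF hTF e he => ?_⟩
    by_contra heT
    refine isForest_iff.1 hF e he (mem_connClosure_of_subset ?_ (hcl e))
    exact fun f hf => ⟨hTF hf, fun h => heT (h ▸ hf)⟩

theorem IsForest.card_add_card_part {F : Finset G.E} (hF : G.IsForest (F : Set G.E)) :
    F.card + Fintype.card (G.Part (F : Set G.E)) = Fintype.card G.V := by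
  classical
  induction F using Finset.induction_on with
  | empty => rw [Finset.coe_empty, card_part_empty]; simp
  | insert e F he ih =>
    have h := isForest_iff.1 hF e (by simp)
    rw [Finset.coe_insert, Set.insert_sdiff_self_of_notMem (by simpa using he)] at h
    rw [← ih (hF.mono (by simp)), Finset.coe_insert, Finset.card_insert_of_notMem he,
      ← card_part_insert h]
    omega

/-- An edge in the closure of a forest lies in the closure of its fundamental circle. -/
theorem IsForest.mem_connClosure_fundamental {T : Set G.E} (hT : G.IsForest T) {e : G.E}
    (he : e ∈ G.connClosure T) : e ∈ G.connClosure {f ∈ T | e ∉ G.connClosure (T \ {f})} := by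
  have := G.finE
  -- A minimal subset of `T` spanning `e`. By exchange, each `f ∈ C` is spanned by `e` and `C \
  -- {f}`; were `e` spanned by `T \ {f}`, then `f` would be too, against independence.
  obtain ⟨C, ⟨hCT, heC⟩, hmin⟩ :=
    (Set.toFinite {C : Set G.E | C ⊆ T ∧ e ∈ G.connClosure C}).exists_minimal ⟨T, subset_rfl, he⟩
  refine mem_connClosure_of_subset (fun f hf => ⟨hCT hf, fun hcl => ?_⟩) heC
  have h1 : e ∉ G.connClosure (C \ {f}) := fun h =>
    (hmin ⟨Set.sdiff_subset.trans hCT, h⟩ Set.sdiff_subset hf).2 rfl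
  have h2 : f ∈ G.connClosure (insert e (C \ {f})) := by
    refine connClosure_exchange ?_ h1
    rwa [Set.insert_sdiff_singleton, Set.insert_eq_of_mem hf]
  refine isForest_iff.1 hT f (hCT hf) (connClosure_subset ?_ h2)
  rw [Set.insert_subset_iff]
  exact ⟨hcl, (Set.sdiff_subset_sdiff_left hCT).trans (subset_connClosure _)⟩

/-! ### Activities and the interval partition -/

section Activity

variable [LinearOrder G.E]

theorem mem_extActive_iff {T : Set G.E} {e : G.E} :
    e ∈ G.extActive T ↔ e ∉ T ∧ e ∈ G.connClosure {f ∈ T | f < e} := by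
  refine and_congr_right fun heT => ⟨?_, fun h => ?_⟩
  · rintro ⟨C, hC, hCT, heC, hmax⟩
    refine mem_connClosure_of_subset ?_ (hC.mem_connClosure heC)
    rintro f ⟨hf, hfe⟩
    exact ⟨(hCT hf).resolve_left hfe, lt_of_le_of_ne (hmax hf) hfe⟩
  · obtain ⟨C, hC, heC, hCT⟩ := exists_isCircle_of_mem_connClosure (fun h => heT h.1) h
    refine ⟨C, hC, fun f hf => (hCT hf).imp_right And.left, heC, fun f hf => ?_⟩
    exact (hCT hf).elim le_of_eq fun h => h.2.le

theorem IsSpanningTree.mem_intActive_iff {T : Set G.E} (hT : G.IsSpanningTree T) {e : G.E} :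
    e ∈ G.intActive T ↔ e ∈ T ∧ ∀ f, e < f → f ∈ G.connClosure (T \ {e}) := by
  rw [isSpanningTree_iff] at hT
  simp only [intActive, clos_eq_connClosure, Set.mem_ofPred_eq]
  refine and_congr_right fun he => ⟨fun h f hf => ?_, fun h => ⟨⟨hT.2 e, ?_⟩, fun f hf => ?_⟩⟩
  · by_contra hcl
    exact (h.2 ⟨hT.2 f, hcl⟩).not_gt hf
  · exact isForest_iff.1 hT.1 e he
  · exact le_of_not_gt fun hlt => hf.2 (h f hlt)

/-- The tree edges `f` of the fundamental circle of `e` are smaller than `e`. Since `e` lies in the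
fundamental cocircuit of each such `f`, none of them is internally active. -/
theorem IsSpanningTree.mem_connClosure_of_extActive {T : Set G.E} (hT : G.IsSpanningTree T)
    {e : G.E} (he : e ∈ G.extActive T) :
    e ∈ G.connClosure {f ∈ G.intInactive T | f < e} := by
  have hT' := isSpanningTree_iff.1 hT
  rw [mem_extActive_iff] at he
  refine mem_connClosure_of_subset ?_ (hT'.1.mem_connClosure_fundamental (hT'.2 e))
  rintro f ⟨hfT, hf⟩
  have hlt : f < e := by
    by_contra hlt
    exact hf (mem_connClosure_of_subset (fun g hg => ⟨hg.1, fun h => hlt (h ▸ hg.2)⟩) he.2)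
  refine ⟨⟨hfT, fun hact => ?_⟩, hlt⟩
  exact hf ((hT.mem_intActive_iff.1 hact).2 e hlt)

/-- The spanning tree whose interval `[T \ IA(T), T ∪ EA(T)]` contains a given edge set. -/
def intervalTree (S : Set G.E) : Set G.E :=
  {e | (e ∈ S ∧ e ∉ G.connClosure {f ∈ S | f < e}) ∨
    (e ∉ S ∧ e ∉ G.connClosure (S ∪ {f | e < f}))}

/-- Uniqueness of the interval. Elements of `S \ T` are externally active, hence spanned by smaller
edges of `T ∩ S`; elements of `T \ S` are internally active, so all larger edges are spanned without
them. Membership in `T` is thereby decided by the two greedy rules. -/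
theorem IsSpanningTree.eq_intervalTree {T S : Set G.E} (hT : G.IsSpanningTree T)
    (h1 : G.intInactive T ⊆ S) (h2 : S ⊆ T ∪ G.extActive T) : T = intervalTree S := by
  have hT' := isSpanningTree_iff.1 hT
  have hfor := isForest_iff.1 hT'.1
  have hS : ∀ e ∈ S, e ∉ T → e ∈ G.connClosure {f ∈ T ∩ S | f < e} := fun e he heT =>
    mem_connClosure_of_subset (fun f hf => ⟨⟨hf.1.1, h1 hf.1⟩, hf.2⟩)
      (hT.mem_connClosure_of_extActive ((h2 he).resolve_left heT))
  have hSlt : ∀ e, {f ∈ S | f < e} ⊆ G.connClosure {f ∈ T ∩ S | f < e} := by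
    rintro e f ⟨hf, hlt⟩
    by_cases hfT : f ∈ T
    · exact subset_connClosure _ ⟨⟨hfT, hf⟩, hlt⟩
    · exact mem_connClosure_of_subset (fun g hg => ⟨hg.1, hg.2.trans hlt⟩) (hS f hf hfT)
  ext e
  by_cases heS : e ∈ S
  · simp only [intervalTree, Set.mem_ofPred_eq, heS, true_and, not_true, false_and, or_false]
    refine ⟨fun heT hcl => ?_, fun h => ?_⟩
    · refine hfor e heT (mem_connClosure_of_subset ?_ (connClosure_subset (hSlt e) hcl))
      exact fun f hf => ⟨hf.1.1, hf.2.ne⟩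
    · by_contra heT
      exact h (mem_connClosure_of_subset (fun f hf => ⟨hf.1.2, hf.2⟩) (hS e heS heT))
  · simp only [intervalTree, Set.mem_ofPred_eq, heS, not_false_iff, true_and, false_and, false_or]
    refine ⟨fun heT hcl => ?_, fun h => ?_⟩
    · have hact : e ∈ G.intActive T := by
        by_contra h
        exact heS (h1 ⟨heT, h⟩)
      refine hfor e heT (connClosure_subset (Set.union_subset ?_ ?_) hcl)
      · intro f hf
        by_cases hfT : f ∈ T
        · exact subset_connClosure _ ⟨hfT, fun h => heS (h ▸ hf)⟩
        · exact mem_connClosure_of_subset (fun g hg => ⟨hg.1.1, fun h => heS (h ▸ hg.1.2)⟩)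
            (hS f hf hfT)
      · exact (hT.mem_intActive_iff.1 hact).2
    · by_contra heT
      refine h (mem_connClosure_of_subset ?_ (hT'.1.mem_connClosure_fundamental (hT'.2 e)))
      rintro f ⟨hfT, hf⟩
      by_cases hfS : f ∈ S
      · exact Or.inl hfS
      · refine Or.inr (lt_of_not_ge fun hle => hf ?_)
        have hact : f ∈ G.intActive T := by
          by_contra h
          exact hfS (h1 ⟨hfT, h⟩)
        refine (hT.mem_intActive_iff.1 hact).2 e (lt_of_le_of_ne hle ?_)
        exact fun h => heT (h ▸ hfT)

theorem mem_connClosure_intervalTree_of_mem (S : Set G.E) {e : G.E} (he : e ∈ S)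
    (heT : e ∉ intervalTree S) : e ∈ G.connClosure {f ∈ intervalTree S ∩ S | f < e} := by
  have := G.finE
  induction e using WellFoundedLT.induction with
  | ind e ih =>
    have hcl : e ∈ G.connClosure {f ∈ S | f < e} := by
      by_contra h
      exact heT (Or.inl ⟨he, h⟩)
    refine connClosure_subset ?_ hcl
    rintro f ⟨hf, hlt⟩
    by_cases hfT : f ∈ intervalTree S
    · exact subset_connClosure _ ⟨⟨hfT, hf⟩, hlt⟩
    · exact mem_connClosure_of_subset (fun g hg => ⟨hg.1, hg.2.trans hlt⟩) (ih f hlt hf hfT)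

theorem subset_connClosure_intervalTree (S : Set G.E) :
    S ⊆ G.connClosure (intervalTree S ∩ S) := by
  intro e he
  by_cases heT : e ∈ intervalTree S
  · exact subset_connClosure _ ⟨heT, he⟩
  · exact mem_connClosure_of_subset (fun f hf => hf.1) (mem_connClosure_intervalTree_of_mem S he heT)

/-- Induction from the largest edge downwards. The sharper form, which records that the tree edges
used outside of `S` are at least `e`, is what later shows that tree edges outside of `S` are
internally active. -/
theorem mem_connClosure_intervalTree (S : Set G.E) (e : G.E) :
    e ∈ G.connClosure ((intervalTree S ∩ S) ∪ {f ∈ intervalTree S | e ≤ f}) := by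
  have := G.finE
  induction e using WellFoundedGT.induction with
  | ind e ih =>
    by_cases heT : e ∈ intervalTree S
    · exact subset_connClosure _ (Or.inr ⟨heT, le_rfl⟩)
    by_cases heS : e ∈ S
    · exact mem_connClosure_of_subset Set.subset_union_left (subset_connClosure_intervalTree S heS)
    have hcl : e ∈ G.connClosure (S ∪ {f | e < f}) := by
      by_contra h
      exact heT (Or.inr ⟨heS, h⟩)
    refine connClosure_subset (Set.union_subset ?_ ?_) hcl
    · exact (subset_connClosure_intervalTree S).trans (connClosure_mono Set.subset_union_left)
    · intro f hf
      exact mem_connClosure_of_subset (Set.union_subset_union_right _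
        fun g hg => ⟨hg.1, le_of_lt (lt_of_lt_of_le hf hg.2)⟩) (ih f hf)

/-- In a circle inside `S`, the largest edge is spanned by smaller edges of `S`. In any other
circle, the smallest edge outside of `S` is spanned by `S` and larger edges. Either edge is rejected
by its greedy rule. -/
theorem isForest_intervalTree (S : Set G.E) : G.IsForest (intervalTree S) := by
  intro C hCT hC
  have := G.finE
  by_cases hCS : C ⊆ S
  · have hne : C.Nonempty := by
      obtain ⟨n, a, e, -, -, -, rfl⟩ := hC
      exact Set.range_nonempty e
    obtain ⟨e, he, hmax⟩ := Set.exists_max_image C id (Set.toFinite C) hne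
    refine ((hCT he).resolve_right fun h => h.1 (hCS he)).2
      (mem_connClosure_of_subset ?_ (hC.mem_connClosure he))
    rintro f ⟨hf, hfe⟩
    exact ⟨hCS hf, lt_of_le_of_ne (hmax f hf) hfe⟩
  · obtain ⟨e, he, hmin⟩ := Set.exists_min_image (C \ S) id (Set.toFinite _)
      (Set.sdiff_nonempty.2 hCS)
    refine ((hCT he.1).resolve_left fun h => he.2 h.1).2
      (mem_connClosure_of_subset ?_ (hC.mem_connClosure he.1))
    rintro f ⟨hf, hfe⟩
    by_cases hfS : f ∈ S
    · exact Or.inl hfS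
    · exact Or.inr (lt_of_le_of_ne (hmin f ⟨hf, hfS⟩) (Ne.symm hfe))

theorem isSpanningTree_intervalTree (S : Set G.E) : G.IsSpanningTree (intervalTree S) :=
  isSpanningTree_iff.2 ⟨isForest_intervalTree S, fun e => mem_connClosure_of_subset
    (Set.union_subset Set.inter_subset_left fun _ hf => hf.1) (mem_connClosure_intervalTree S e)⟩

theorem intInactive_intervalTree_subset (S : Set G.E) : G.intInactive (intervalTree S) ⊆ S := by
  rintro e ⟨heT, he⟩
  by_contra heS
  refine he ((isSpanningTree_intervalTree S).mem_intActive_iff.2 ⟨heT, fun f hf => ?_⟩)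
  refine mem_connClosure_of_subset ?_ (mem_connClosure_intervalTree S f)
  rintro g (hg | hg)
  · exact ⟨hg.1, fun h => heS (h ▸ hg.2)⟩
  · exact ⟨hg.1, (lt_of_lt_of_le hf hg.2).ne'⟩

theorem subset_intervalTree_union_extActive (S : Set G.E) :
    S ⊆ intervalTree S ∪ G.extActive (intervalTree S) := by
  intro e he
  refine or_iff_not_imp_left.2 fun heT => mem_extActive_iff.2 ⟨heT, ?_⟩
  exact mem_connClosure_of_subset (fun f hf => ⟨hf.1.1, hf.2⟩)
    (mem_connClosure_intervalTree_of_mem S he heT)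

theorem intervalTree_eq_iff {S T : Set G.E} (hT : G.IsSpanningTree T) :
    intervalTree S = T ↔ G.intInactive T ⊆ S ∧ S ⊆ T ∪ G.extActive T := by
  constructor
  · rintro rfl
    exact ⟨intInactive_intervalTree_subset S, subset_intervalTree_union_extActive S⟩
  · rintro ⟨h1, h2⟩
    exact (hT.eq_intervalTree h1 h2).symm

variable [AddCommSemigroup W]

-- The edges of `A` are spanned by `F`, so they do not change the components; as `F` is a forest,
-- `|F| + c(F) = |V|` and only `|A|` remains in the exponent.
open Classical in
theorem IsSpanningTree.dichromaticTerm_union {T : Set G.E} (hT : G.IsSpanningTree T)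
    {F A : Finset G.E} (hF : G.intInactive T ⊆ F) (hFT : (F : Set G.E) ⊆ T)
    (hA : (A : Set G.E) ⊆ G.extActive T) :
    G.dichromaticTerm (F ∪ A) = vVar ^ A.card * G.partMonomial (F : Set G.E) := by
  have hcl : (A : Set G.E) ⊆ G.connClosure F := fun e he =>
    mem_connClosure_of_subset (fun f hf => hF hf.1) (hT.mem_connClosure_of_extActive (hA he))
  have hpart : ∀ a b, G.part (F ∪ A : Set G.E) a = G.part (F ∪ A : Set G.E) b ↔
      G.part F a = G.part F b := fun a b =>
    ⟨part_eq_of_subset_connClosure (Set.union_subset (subset_connClosure _) hcl),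
      part_mono Set.subset_union_left⟩
  have hdisj : Disjoint F A := Finset.disjoint_left.2 fun e he he' => (hA he').1 (hFT he)
  rw [dichromaticTerm, Finset.coe_union, card_part_congr hpart, partMonomial_congr hpart,
    Finset.card_union_of_disjoint hdisj,
    ← (hT.prop.mono hFT).card_add_card_part]
  congr 2
  omega

theorem dichromatic_eq_treeExpansion (G : WeightedGraph.{u} W) [LinearOrder G.E] :
    G.dichromatic = G.treeExpansion := by
  classical
  have hmaps : ∀ S ∈ (Finset.univ : Finset (Finset G.E)),
      (Set.toFinite (intervalTree (S : Set G.E))).toFinset ∈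
        Finset.univ.filter (fun T : Finset G.E => G.IsSpanningTree (T : Set G.E)) := by
    intro S _
    simpa using isSpanningTree_intervalTree (S : Set G.E)
  rw [dichromatic_eq_sum, ← Finset.sum_fiberwise_of_maps_to hmaps, treeExpansion]
  refine Finset.sum_congr rfl fun T hT => ?_
  replace hT : G.IsSpanningTree (T : Set G.E) := by simpa using hT
  set EA := (Set.toFinite (G.extActive (T : Set G.E))).toFinset with hEA
  have hiff : ∀ S : Finset G.E, (Set.toFinite (intervalTree (S : Set G.E))).toFinset = T ↔
      G.intInactive (T : Set G.E) ⊆ S ∧ (S : Set G.E) ⊆ T ∪ G.extActive (T : Set G.E) := by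
    intro S
    rw [← intervalTree_eq_iff hT, ← Finset.coe_inj, Set.Finite.coe_toFinset]
  have hpow : (vVar + 1 : DPoly W) ^ (G.extActive (T : Set G.E)).ncard =
      ∑ A ∈ EA.powerset, vVar ^ A.card := by
    rw [Set.ncard_eq_toFinset_card _ (Set.toFinite _), ← Finset.sum_pow_mul_eq_add_pow]
    simp [hEA]
  rw [hpow, Finset.sum_mul_sum, ← Finset.sum_product']
  symm
  -- A set in the interval of `T` splits into its externally active part outside of `T` and its part
  -- in `T`.
  refine Finset.sum_bij' (fun x _ => x.2 ∪ x.1) (fun S _ => (S \ T, S ∩ T)) ?_ ?_ ?_ ?_ ?_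
  · rintro ⟨A, F⟩ h
    simp only [Finset.mem_product, Finset.mem_filter, Finset.mem_powerset] at h
    simp only [Finset.mem_filter, Finset.mem_univ, true_and, hiff, Finset.coe_union]
    refine ⟨h.2.2.trans Set.subset_union_left, Set.union_subset_union h.2.1 ?_⟩
    intro e he
    simpa [hEA] using h.1 he
  · intro S h
    simp only [Finset.mem_filter, Finset.mem_univ, true_and, hiff] at h
    simp only [Finset.mem_product, Finset.mem_filter, Finset.mem_powerset, Finset.coe_inter]
    refine ⟨fun e he => ?_, Finset.inter_subset_right, fun e he => ⟨h.1 he, he.1⟩⟩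
    rw [Finset.mem_sdiff] at he
    simpa [hEA] using (h.2 he.1).resolve_left he.2
  · rintro ⟨A, F⟩ h
    simp only [Finset.mem_product, Finset.mem_filter, Finset.mem_powerset] at h
    have hdisj : ∀ e ∈ A, e ∉ T := fun e he => by
      have : e ∈ G.extActive (T : Set G.E) := by simpa [hEA] using h.1 he
      exact this.1
    ext e
    · have : e ∈ F → e ∈ T := fun he => h.2.1 he
      have := hdisj e
      simp only [Finset.mem_sdiff, Finset.mem_union]
      tauto
    · have : e ∈ F → e ∈ T := fun he => h.2.1 he
      have := hdisj e
      simp only [Finset.mem_inter, Finset.mem_union]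
      tauto
  · intro S _
    ext e
    simp only [Finset.mem_sdiff, Finset.mem_inter, Finset.mem_union]
    tauto
  · rintro ⟨A, F⟩ h
    simp only [Finset.mem_product, Finset.mem_filter, Finset.mem_powerset] at h
    refine (hT.dichromaticTerm_union h.2.2 h.2.1 ?_).symm
    intro e he
    simpa [hEA] using h.1 he

end Activity

end Circles

/-! ### Multiplicativity over components -/

section Components

variable (G : WeightedGraph.{u} W)

/-- The edges of a component, as edges of the graph. -/
def componentEdge (B : G.Part Set.univ) : (G.component B).E ↪ G.E := Function.Embedding.subtype _

/-- The vertices of a component, as vertices of the graph. -/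
def componentVert (B : G.Part Set.univ) : (G.component B).V ↪ G.V := Function.Embedding.subtype _

/-- A vertex, as a vertex of its component. -/
def toComponent (a : G.V) : (G.component (G.part Set.univ a)).V := ⟨a, rfl⟩

theorem map_ends_component (B : G.Part Set.univ) (e : (G.component B).E) :
    ((G.component B).ends e).map (G.componentVert B) = G.ends (G.componentEdge B e) :=
  Sym2.attachWith_map_subtypeVal _

theorem exists_componentEdge_eq (e : G.E) : ∃ x : Σ B, (G.component B).E,
    G.componentEdge x.1 x.2 = e := by
  obtain ⟨a, b, hab⟩ := exists_ends e
  have h : G.part Set.univ a = G.part Set.univ b :=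
    (mem_connClosure_iff hab).1 (subset_connClosure _ (Set.mem_univ e))
  refine ⟨⟨G.part Set.univ a, ⟨e, ?_⟩⟩, rfl⟩
  intro c hc
  rw [hab, Sym2.mem_iff] at hc
  rcases hc with rfl | rfl
  · rfl
  · exact h.symm

/-- The edges of a graph are distributed over its components. -/
noncomputable def sigmaComponentEdge : (Σ B, (G.component B).E) ≃ G.E :=
  Equiv.ofBijective (fun x => G.componentEdge x.1 x.2) (by
    refine ⟨?_, G.exists_componentEdge_eq⟩
    rintro ⟨B, e⟩ ⟨B', e'⟩ h
    replace h : G.componentEdge B e = G.componentEdge B' e' := h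
    obtain rfl : B = B' := by
      obtain ⟨a, b, hab⟩ := exists_ends (G.componentEdge B e)
      have ha : a ∈ G.ends (G.componentEdge B e) := by simp [hab]
      rw [← e.2 a ha]
      exact e'.2 a (by
        have : a ∈ G.ends (G.componentEdge B' e') := h ▸ ha
        exact this)
    rw [(G.componentEdge B).injective h])

/-- The vertices of a graph are distributed over its components. -/
def sigmaComponentVert : (Σ B, (G.component B).V) ≃ G.V :=
  Equiv.sigmaFiberEquiv (G.part Set.univ)

/-- The edge set whose traces on the components are given. -/
noncomputable def unionEdges (S : ∀ B, Finset (G.component B).E) : Finset G.E :=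
  (Finset.univ.sigma S).map G.sigmaComponentEdge.toEmbedding

variable {G}

theorem mem_unionEdges {S : ∀ B, Finset (G.component B).E} {e : G.E} :
    e ∈ G.unionEdges S ↔ ∃ B, ∃ x ∈ S B, G.componentEdge B x = e := by
  simp only [unionEdges, Finset.mem_map, Finset.mem_sigma, Finset.mem_univ, true_and]
  constructor
  · rintro ⟨⟨B, x⟩, hx, rfl⟩
    exact ⟨B, x, hx, rfl⟩
  · rintro ⟨B, x, hx, rfl⟩
    exact ⟨⟨B, x⟩, hx, rfl⟩

variable (G) in
/-- The class of a vertex in the subgraph of its component with a given edge set. -/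
def sigmaPart (S : ∀ B, Finset (G.component B).E) (a : G.V) :
    Σ B, (G.component B).Part (S B : Set (G.component B).E) :=
  ⟨G.part Set.univ a, (G.component _).part _ (G.toComponent a)⟩

theorem sigmaPart_componentVert (S : ∀ B, Finset (G.component B).E) {B : G.Part Set.univ}
    (a : (G.component B).V) :
    G.sigmaPart S (G.componentVert B a) = ⟨B, (G.component B).part _ a⟩ := by
  obtain ⟨a, rfl⟩ := a
  rfl

/-- No edge leaves a component of the graph, so a class of the union is a component `B` together
with a class inside it. -/
theorem part_unionEdges_iff (S : ∀ B, Finset (G.component B).E) (a b : G.V) :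
    G.part (G.unionEdges S : Set G.E) a = G.part (G.unionEdges S : Set G.E) b ↔
      G.sigmaPart S a = G.sigmaPart S b := by
  constructor
  · intro h
    refine eq_of_part_eq (G.sigmaPart S) ?_ h
    intro e he
    obtain ⟨B, x, hx, rfl⟩ := mem_unionEdges.1 he
    obtain ⟨c, d, hcd⟩ := exists_ends x
    rw [← map_ends_component, hcd, Sym2.map_mk, Sym2.map_mk, Sym2.mk_isDiag_iff,
      sigmaPart_componentVert, sigmaPart_componentVert,
      (mem_connClosure_iff hcd).1 (subset_connClosure (S B : Set (G.component B).E) hx)]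
  · have key : ∀ (B) (x y : (G.component B).V),
        (G.component B).part (S B : Set (G.component B).E) x = (G.component B).part (S B : Set (G.component B).E) y →
        G.part (G.unionEdges S : Set G.E) (G.componentVert B x) =
          G.part (G.unionEdges S : Set G.E) (G.componentVert B y) := by
      intro B x y h
      refine eq_of_part_eq
        (fun x => G.part (G.unionEdges S : Set G.E) (G.componentVert B x)) ?_ h
      intro e he
      rw [Sym2.isDiag_map_comp, map_ends_component]
      exact subset_connClosure (G.unionEdges S : Set G.E) (mem_unionEdges.2 ⟨B, e, he, rfl⟩)
    intro h
    have h1 : G.part Set.univ a = G.part Set.univ b := congrArg Sigma.fst h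
    have h2 := h.trans (sigmaPart_componentVert S (B := G.part Set.univ a) ⟨b, h1.symm⟩)
    exact key _ (G.toComponent a) ⟨b, h1.symm⟩ (eq_of_heq (Sigma.mk.inj h2).2)

variable [AddCommSemigroup W]

theorem exists_sigmaPart_equiv (S : ∀ B, Finset (G.component B).E) :
    ∃ φ : G.Part (G.unionEdges S : Set G.E) ≃ Σ B, (G.component B).Part (S B : Set (G.component B).E),
      ∀ C, G.blockWeight _ C = (G.component (φ C).1).blockWeight _ (φ C).2 := by
  classical
  obtain ⟨φ, hφ⟩ := exists_equiv_of_surjective (part_surjective (G.unionEdges S : Set G.E))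
    (q := G.sigmaPart S) (by
      rintro ⟨B, C⟩
      obtain ⟨a, rfl⟩ := part_surjective _ C
      exact ⟨G.componentVert B a, sigmaPart_componentVert S a⟩) (part_unionEdges_iff S)
  refine ⟨φ, fun C => WithZero.coe_injective ?_⟩
  obtain ⟨⟨B, D⟩, rfl⟩ := φ.symm.surjective C
  rw [coe_blockWeight, Equiv.apply_symm_apply, coe_blockWeight]
  symm
  refine Finset.sum_bij (fun a _ => G.componentVert B a) ?_ ?_ ?_ ?_
  · intro a ha
    have ha : (G.component B).part (S B : Set (G.component B).E) a = D := (Finset.mem_filter.1 ha).2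
    refine Finset.mem_filter.2 ⟨Finset.mem_univ _, ?_⟩
    rw [Equiv.eq_symm_apply, hφ, sigmaPart_componentVert, ha]
  · intro a _ b _ h
    exact (G.componentVert B).injective h
  · intro a ha
    have ha := (Finset.mem_filter.1 ha).2
    rw [Equiv.eq_symm_apply, hφ] at ha
    obtain rfl : G.part Set.univ a = B := congrArg Sigma.fst ha
    refine ⟨G.toComponent a, Finset.mem_filter.2 ⟨Finset.mem_univ _, ?_⟩, rfl⟩
    exact eq_of_heq (Sigma.mk.inj ha).2
  · intro a _
    rfl

theorem dichromaticTerm_unionEdges (S : ∀ B, Finset (G.component B).E) :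
    G.dichromaticTerm (G.unionEdges S) = ∏ B, (G.component B).dichromaticTerm (S B) := by
  classical
  obtain ⟨φ, hφ⟩ := exists_sigmaPart_equiv S
  have hmon : G.partMonomial (G.unionEdges S : Set G.E) =
      ∏ B, (G.component B).partMonomial (S B : Set (G.component B).E) := by
    simp only [partMonomial]
    rw [← Fintype.prod_sigma']
    exact Fintype.prod_equiv φ _ _ fun C => by rw [hφ]
  have hpart : Fintype.card (G.Part (G.unionEdges S : Set G.E)) =
      ∑ B, Fintype.card ((G.component B).Part (S B : Set (G.component B).E)) := by
    rw [Fintype.card_congr φ, Fintype.card_sigma]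
  have hV : Fintype.card G.V = ∑ B, Fintype.card (G.component B).V := by
    rw [← Fintype.card_congr G.sigmaComponentVert, Fintype.card_sigma]
  have hS : (G.unionEdges S).card = ∑ B, (S B).card := by
    rw [unionEdges, Finset.card_map, Finset.card_sigma]
  simp only [dichromaticTerm]
  rw [Finset.prod_mul_distrib, Finset.prod_pow_eq_pow_sum, hmon, hpart, hV, hS,
    ← Finset.sum_add_distrib,
    -- Truncated subtraction commutes with the sum because it is a true subtraction in every
    -- component.
    Finset.sum_tsub_distrib _ fun B _ => card_le_card_add_card_part (S B)]

theorem dichromatic_eq_prod_component (G : WeightedGraph.{u} W) :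
    G.dichromatic = ∏ B : G.Part Set.univ, (G.component B).dichromatic := by
  classical
  simp only [dichromatic_eq_sum]
  -- Expanding the product of sums gives a sum over families of edge sets, which `unionEdges`
  -- matches with the edge sets of the whole graph.
  rw [Finset.prod_univ_sum, Fintype.piFinset_univ]
  symm
  refine Fintype.sum_bijective G.unionEdges ⟨?_, ?_⟩ _ _ fun S =>
    (dichromaticTerm_unionEdges S).symm
  · intro S S' h
    have h := Finset.map_injective _ h
    funext B
    ext e
    simpa using Finset.ext_iff.1 h ⟨B, e⟩
  · intro S
    refine ⟨fun B => Finset.univ.filter fun e => G.componentEdge B e ∈ S, ?_⟩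
    ext e
    rw [mem_unionEdges]
    constructor
    · rintro ⟨B, x, hx, rfl⟩
      simpa using hx
    · intro he
      obtain ⟨⟨B, x⟩, rfl⟩ := G.exists_componentEdge_eq e
      exact ⟨B, x, by simpa using he, rfl⟩

end Components

end WeightedGraph

/-- The dichromatic polynomial satisfies deletion-contraction, isomorphism invariance, unitarity,
the initial condition and the loop identity.  It is universal with these properties: for all values
`x` and `y` of the variables in a commutative ring, a function has the properties if and only if it
is the evaluation of the dichromatic polynomial at these values.  It is multiplicative over
connected components, and it has the spanning-tree expansion for every linear ordering of the
edges. -/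
theorem theoremT (W : Type w) [AddCommSemigroup W] :
    WeightedGraph.TutteConditions
      (fun G : WeightedGraph.{u} W => G.dichromatic) WeightedGraph.uVar WeightedGraph.vVar ∧
    (∀ (R : Type r) [CommRing R] (f : WeightedGraph.{u} W → R) (x : W → R) (y : R),
      WeightedGraph.TutteConditions f x y ↔
        ∀ G : WeightedGraph.{u} W, f G = WeightedGraph.subst x y G.dichromatic) ∧
    (∀ G : WeightedGraph.{u} W,
      G.dichromatic = ∏ B : G.Part Set.univ, (G.component B).dichromatic) ∧
    (∀ (G : WeightedGraph.{u} W) [LinearOrder G.E], G.dichromatic = G.treeExpansion) :=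
  ⟨WeightedGraph.tutteConditions_dichromatic, fun _ _ => WeightedGraph.tutteConditions_iff,
    WeightedGraph.dichromatic_eq_prod_component, WeightedGraph.dichromatic_eq_treeExpansion⟩
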